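/- For an interval $I=[a,b]$, $a<b$, let $2I$ be the interval with the same centre and twice the length. For $0<\alpha<1$ and $h\ge 0$ on $\mathbb R$ put $I_\alpha h(x)=\int_{\mathbb R}|x-y|^{\alpha-1}h(y)\,dy$, and for compact $E\subset I$ put $$\mathbf{Cap}_\alpha(E;I)=\inf\Big\{\int h\,dx:\ h\ge 0,\ \operatorname{supp}h\subset 2I,\ I_\alpha h\ge |2I|^{\alpha-1}\text{ on }E\Big\}.$$ A locally finite positive Borel measure $\omega$ on $\mathbb R$ satisfies the fractional $\mathcal A_\infty^\alpha$ condition with the function $\eta:[0,1]\to[0,1]$, $\lim_{t\to 0}\eta(t)=0$, if $\omega(E)/\omega(2I)\le \eta(\mathbf{Cap}_\alpha(E;I))$ for every interval $I$ with $\omega(2I)>0$ and every compact $E\subset I$. It is doubling if $\omega\neq 0$ and there is $K$ with $\omega(2I)\le K\omega(I)$ for all intervals $I$. It is an $A_\infty$ weight if it is an $A_p$ weight for some $p>1$, i.e. $d\omega=w\,dx$ and $\sup_I\big(\frac1{|I|}\int_I w\big)\big(\frac1{|I|}\int_I w^{\frac1{1-p}}\big)^{p-1}<\infty$. **Theorem.**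 Let $0<\delta<\frac13$. There is a locally finite $1$-periodic Borel measure $\mu$ on $\mathbb R$ with $\mu([0,1])=1$ such that the middle third of every triadic interval $J\subset[0,1]$ has measure $\delta\mu(J)$ and each of the two outer thirds has measure $\frac{1-\delta}2\mu(J)$ (the triadic Garnett–Killip–Schul measure), and such that 1. $\mu$ is singular with respect to Lebesgue measure; 2. $\mu$ is doubling; 3. there is $\alpha_0\in(0,1)$ such that for all $\alpha\in(\alpha_0,1)$ the measure $\mu$ satisfies the fractional $\mathcal A_\infty^\alpha$ condition with $\eta(t)=t$; moreover, for every $\alpha$ with $1-\frac{\ln(2/(1-\delta))}{\ln 3}<\alpha<1$ there is $C<\infty$ such that $\mu$ satisfies the $\mathcal A_\infty^\alpha$ condition with $\eta(t)=\min(Ct,1)$; 4. $\mu$ is not an $A_\infty$ weight; nor are there $C,\varepsilon>0$ with $\mu(E)\le C(|E|/|I|)^{\varepsilon}\mu(I)$ for all intervals $I$ and all Borel sets $E\subset I$. -/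

import Mathlib

open MeasureTheory Set Filter Topology
open scoped ENNReal NNReal

noncomputable section

namespace FracAInf

/-- The interval `2I` for `I = [a, b]`: same centre, twice the length. -/
def dbl (a b : ℝ) : Set ℝ := Icc (a - (b - a) / 2) (b + (b - a) / 2)

/-- `ω` is a doubling measure on the line: it is not the zero measure, and
`ω (2I) ≤ K ω (I)` for all intervals `I`. -/
def IsDoubling (ω : Measure ℝ) : Prop :=
  ω ≠ 0 ∧ ∃ K : ℝ≥0, ∀ a b : ℝ, a < b → ω (dbl a b) ≤ K * ω (Icc a b)

/-- The Riesz potential `I_α h (x) = ∫ |x - y| ^ (α - 1) h(y) dy` of a nonnegative function on the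
line (for `α < 1` the kernel has the value `∞` at `y = x`). -/
def rieszPotential (α : ℝ) (h : ℝ → ℝ≥0∞) (x : ℝ) : ℝ≥0∞ :=
  ∫⁻ y, ENNReal.ofReal |x - y| ^ (α - 1) * h y

/-- The relative capacity `Cap_α (E; I)` for `I = [a, b]`: the infimum of `∫ h` over measurable
`h ≥ 0` supported in `2I` with `I_α h ≥ (diam 2I) ^ (α - 1)` on `E`. As `2I` is closed, it is the
same to ask for the set where `h ≠ 0` or for its closure to lie in `2I`. -/
def relCap (α : ℝ) (E : Set ℝ) (a b : ℝ) : ℝ≥0∞ :=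
  sInf {c | ∃ h : ℝ → ℝ≥0∞, Measurable h ∧ Function.support h ⊆ dbl a b ∧
    (∀ x ∈ E, ENNReal.ofReal (2 * (b - a)) ^ (α - 1) ≤ rieszPotential α h x) ∧
    c = ∫⁻ x, h x}

/-- `ω` satisfies the fractional `𝒜_∞^α` condition with the function `η : [0,1] → [0,1]`
(given as a function on `[0, ∞]` of which only the restriction to `[0,1]` matters). -/
def IsFracAInftyWith (α : ℝ) (η : ℝ≥0∞ → ℝ≥0∞) (ω : Measure ℝ) : Prop :=
  IsLocallyFiniteMeasure ω ∧
  MapsTo η (Icc 0 1) (Icc 0 1) ∧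
  Tendsto η (𝓝[Icc 0 1] 0) (𝓝 0) ∧
  ∀ a b : ℝ, a < b → 0 < ω (dbl a b) →
    ∀ E : Set ℝ, IsCompact E → E ⊆ Icc a b →
      ω E / ω (dbl a b) ≤ η (relCap α E a b)

/-- `ω` is an `A_p` weight: `dω = w dx` with `w ≥ 0` locally integrable and
`sup_I (⨍_I w) (⨍_I w ^ (1 / (1 - p))) ^ (p - 1) < ∞`. -/
def IsAp (p : ℝ) (ω : Measure ℝ) : Prop :=
  IsLocallyFiniteMeasure ω ∧
  ∃ w : ℝ → ℝ≥0∞, Measurable w ∧ ω = volume.withDensity w ∧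
    ∃ C : ℝ≥0, ∀ a b : ℝ, a < b →
      ((∫⁻ x in Icc a b, w x) / volume (Icc a b)) *
        ((∫⁻ x in Icc a b, w x ^ (1 / (1 - p))) / volume (Icc a b)) ^ (p - 1) ≤ C

/-- `A_∞` is the union of the classes `A_p`, `p > 1`. -/
def IsAInfty (ω : Measure ℝ) : Prop := ∃ p : ℝ, 1 < p ∧ IsAp p ω

/-- The usual other form of `A_∞`: there are `C, ε > 0` with
`ω (E) ≤ C (|E| / |I|) ^ ε ω (I)` for all intervals `I` and all Borel sets `E ⊆ I`. -/
def AInftyInequality (ω : Measure ℝ) : Prop :=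
  ∃ (C : ℝ≥0) (ε : ℝ), 0 < ε ∧ ∀ a b : ℝ, a < b → ∀ E : Set ℝ, MeasurableSet E → E ⊆ Icc a b →
    ω E ≤ C * (volume E / volume (Icc a b)) ^ ε * ω (Icc a b)

/-- The triadic interval `[k / 3 ^ m, (k + 1) / 3 ^ m]`. -/
def triadic (m : ℕ) (k : ℤ) : Set ℝ := Icc ((k : ℝ) / 3 ^ m) (((k : ℝ) + 1) / 3 ^ m)

/-- `μ` is the triadic Garnett–Killip–Schul measure with parameter `δ`, as a `1`-periodic measure
on the line: `μ [0,1] = 1`, and the middle third of a triadic interval `J ⊆ [0,1]` has measure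
`δ μ(J)`, the two outer thirds have measure `(1 - δ) / 2 * μ(J)`. -/
def IsGKS (δ : ℝ) (μ : Measure ℝ) : Prop :=
  μ (Icc 0 1) = 1 ∧
  μ.map (fun x => x + 1) = μ ∧
  ∀ (m : ℕ) (k : ℤ), 0 ≤ k → k < 3 ^ m →
    μ (triadic (m + 1) (3 * k)) = ENNReal.ofReal ((1 - δ) / 2) * μ (triadic m k) ∧
    μ (triadic (m + 1) (3 * k + 1)) = ENNReal.ofReal δ * μ (triadic m k) ∧
    μ (triadic (m + 1) (3 * k + 2)) = ENNReal.ofReal ((1 - δ) / 2) * μ (triadic m k)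

end FracAInf

end

/-! On `[0,1]` the measure is the law of a random ternary expansion with independent digits of
weights `p 0 = p 2 = (1 - δ) / 2` and `p 1 = δ`, repeated with period one. Write `q = (1 - δ) / 2`
for the largest weight. Since the outer weights agree, adjacent triadic cells have comparable masses
at every scale (`IsTriadic.neighbour`), which gives doubling.

Capacity is handled by duality (`measure_div_le_mul_relCap`): by Tonelli, a bound `D |2I|^(α-1)
μ(2I)` on the potential of `μ` restricted to `I`, uniform over all points, yields `μ(E) / μ(2I) ≤ D
Cap_α(E; I)`. For the potential bound, each refinement of scale around a point multiplies the mass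
by at most `q` and the kernel by `3^(1-α)`, so a geometric series converges once `3^(1-α) q < 1`
(`IsCellRegular.exists_potential_le`); this is the threshold on `α` in the theorem. Hölder
interpolation between one such exponent and exponent zero gives the constant `C^θ γ^(1-θ)`, where
`μ(I) ≤ γ μ(2I)` with `γ < 1` by reverse doubling. For small `θ`, that is, for `α` near 1, it is at
most 1.

Passing to a child multiplies the mean density of a cell by some `3 p j ≠ 1`, so the density has no
positive finite limit and `μ` is singular by Lebesgue differentiation. Either form of `A_∞` would
force `μ ≪ volume`. -/

noncomputable section

namespace FracAInf

/-! ### Self-similar measures from random ternary digits -/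

/-- Prepend a ternary digit to a sequence of digits. -/
def consDigit (j : Fin 3) (d : ℕ → Fin 3) : ℕ → Fin 3
  | 0 => j
  | n + 1 => d n

lemma measurable_consDigit (j : Fin 3) : Measurable (consDigit j) := by
  refine measurable_pi_lambda _ fun n => ?_
  cases n with
  | zero => exact measurable_const
  | succ n => exact measurable_pi_apply n

lemma ofDigits_consDigit (j : Fin 3) (d : ℕ → Fin 3) :
    Real.ofDigits (consDigit j d) = (Real.ofDigits d + (j : ℕ)) / 3 := by
  rw [Real.ofDigits_eq_sum_add_ofDigits _ 1]
  have : (fun i => consDigit j d (i + 1)) = d := rfl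
  rw [this]
  simp [Real.ofDigitsTerm, consDigit]
  ring

/-- Conditioning on the first digit: the remaining digits of an i.i.d. sequence have the law of the
whole sequence. It suffices to compare both sides on boxes. -/
lemma infinitePi_eq_sum_map_consDigit (P : Measure (Fin 3)) [IsProbabilityMeasure P] :
    Measure.infinitePi (fun _ : ℕ => P) =
      ∑ j, P {j} • (Measure.infinitePi (fun _ : ℕ => P)).map (consDigit j) := by
  symm
  refine Measure.eq_infinitePi _ fun s t ht => ?_
  classical
  -- An initial segment `range (N + 1)` always contains coordinate 0, which can then be split off.
  obtain ⟨N, hN⟩ : ∃ N : ℕ, s ⊆ Finset.range (N + 1) :=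
    ⟨s.sup id, fun i hi => Finset.mem_range.2 (Nat.lt_succ_of_le (Finset.le_sup (f := id) hi))⟩
  set t' : ℕ → Set (Fin 3) := fun i => if i ∈ s then t i else univ with ht'
  have hpi : (Set.pi s t) = Set.pi (Finset.range (N + 1)) t' := by
    ext x
    simp only [Set.mem_pi, Finset.mem_coe, ht']
    constructor
    · intro h i _
      split_ifs with his
      · exact h i his
      · trivial
    · intro h i hi
      have := h i (hN hi)
      rwa [if_pos hi] at this
  have hprod : ∏ i ∈ s, P (t i) = ∏ i ∈ Finset.range (N + 1), P (t' i) := by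
    rw [← Finset.prod_subset hN]
    · refine Finset.prod_congr rfl fun i hi => ?_
      simp [ht', hi]
    · intro i _ hi
      simp [ht', hi]
  rw [hpi, hprod, Finset.prod_range_succ']
  have hm : MeasurableSet (Set.pi (Finset.range (N + 1)) t') :=
    MeasurableSet.pi (Finset.countable_toSet _) fun i _ => MeasurableSet.of_discrete
  have key : ∀ j, (Measure.infinitePi (fun _ : ℕ => P)).map (consDigit j)
      (Set.pi (Finset.range (N + 1)) t') =
      (∏ i ∈ Finset.range N, P (t' (i + 1))) * (t' 0).indicator 1 j := by
    intro j
    rw [Measure.map_apply (measurable_consDigit j) hm]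
    by_cases hj : j ∈ t' 0
    · have : consDigit j ⁻¹' (Set.pi (Finset.range (N + 1)) t') =
          Set.pi (Finset.range N) fun i => t' (i + 1) := by
        ext d
        simp only [Set.mem_preimage, Set.mem_pi, Finset.mem_coe, Finset.mem_range]
        constructor
        · intro h i hi
          exact h (i + 1) (by omega)
        · intro h i hi
          cases i with
          | zero => exact hj
          | succ i => exact h i (by omega)
      rw [this, Measure.infinitePi_pi _ fun i _ => MeasurableSet.of_discrete]
      simp [hj]
    · have : consDigit j ⁻¹' (Set.pi (Finset.range (N + 1)) t') = ∅ := by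
        ext d
        simp only [Set.mem_preimage, Set.mem_pi, Finset.mem_coe, Finset.mem_range,
          mem_empty_iff_false, iff_false]
        intro h
        exact hj (h 0 (by omega))
      rw [this, measure_empty]
      simp [hj]
  simp only [Measure.finsetSum_apply, Measure.smul_apply, smul_eq_mul, key]
  have hP : P (t' 0) = ∑ j, P {j} * (t' 0).indicator 1 j := by
    conv_lhs => rw [← Measure.sum_smul_dirac P, Measure.sum_apply _ MeasurableSet.of_discrete]
    simp [tsum_fintype]
  rw [hP, Finset.mul_sum]
  exact Finset.sum_congr rfl fun j _ => by ring

/-- The self-similar probability measure on `[0, 1]` with weights `p` for the three maps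
`x ↦ (x + j) / 3`. -/
lemma exists_selfSimilar (p : Fin 3 → ℝ≥0∞) (hp : ∑ j, p j = 1) :
    ∃ μ : Measure ℝ, IsProbabilityMeasure μ ∧ μ (Icc 0 1)ᶜ = 0 ∧
      ∀ A, MeasurableSet A → μ A = ∑ j, p j * μ ((fun x : ℝ => (x + (j : ℕ)) / 3) ⁻¹' A) := by
  set P : Measure (Fin 3) := (PMF.ofFintype p hp).toMeasure with hP
  have hPj : ∀ j, P {j} = p j := fun j => by
    rw [hP, PMF.toMeasure_apply_singleton _ _ (measurableSet_singleton j)]; rfl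
  set ν := Measure.infinitePi (fun _ : ℕ => P) with hν
  have hmeas : Measurable (Real.ofDigits (b := 3)) := Real.continuous_ofDigits.measurable
  refine ⟨ν.map Real.ofDigits, Measure.isProbabilityMeasure_map hmeas.aemeasurable, ?_, ?_⟩
  · rw [Measure.map_apply hmeas measurableSet_Icc.compl]
    have : (Real.ofDigits (b := 3)) ⁻¹' (Icc 0 1)ᶜ = ∅ := by
      ext d
      simp [Real.ofDigits_nonneg, Real.ofDigits_le_one]
    rw [this, measure_empty]
  · intro A hA
    have hf : ∀ j : Fin 3, Measurable fun x : ℝ => (x + (j : ℕ)) / 3 := fun j => by fun_prop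
    conv_lhs => rw [Measure.map_apply hmeas hA, hν, infinitePi_eq_sum_map_consDigit]
    simp only [Measure.finsetSum_apply, Measure.smul_apply, smul_eq_mul, hPj]
    refine Finset.sum_congr rfl fun j _ => ?_
    rw [Measure.map_apply (measurable_consDigit j) (hmeas hA),
      Measure.map_apply hmeas (hf j hA)]
    congr 2
    ext d
    simp [ofDigits_consDigit]

/-! ### Periodic measures with prescribed triadic ratios -/

lemma measurableSet_triadic (m : ℕ) (k : ℤ) : MeasurableSet (triadic m k) := measurableSet_Icc

lemma preimage_triadic_succ (m : ℕ) (k : ℤ) (j : ℕ) :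
    (fun x : ℝ => (x + j) / 3) ⁻¹' triadic (m + 1) k = triadic m (k - j * 3 ^ m) := by
  ext x
  have h3 : (0 : ℝ) < 3 ^ m := by positivity
  simp only [triadic, mem_preimage, mem_Icc, pow_succ, div_le_div_iff₀ (mul_pos h3 three_pos)
    three_pos, div_le_div_iff₀ three_pos (mul_pos h3 three_pos), div_le_iff₀ h3, le_div_iff₀ h3]
  push_cast
  constructor <;> rintro ⟨h1, h2⟩ <;> constructor <;> nlinarith

lemma preimage_add_triadic (m : ℕ) (k n : ℤ) :
    (fun x : ℝ => x + n) ⁻¹' triadic m k = triadic m (k - n * 3 ^ m) := by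
  ext x
  have h3 : (0 : ℝ) < 3 ^ m := by positivity
  simp only [triadic, mem_preimage, mem_Icc, div_le_iff₀ h3, le_div_iff₀ h3]
  push_cast
  constructor <;> rintro ⟨h1, h2⟩ <;> constructor <;> nlinarith

/-- The masses of the triadic intervals of a one-periodic measure in which the thirds of a triadic
interval have the relative masses `p 0`, `p 1`, `p 2`. -/
structure IsTriadic (p : Fin 3 → ℝ≥0∞) (μ : Measure ℝ) : Prop where
  periodic : μ.map (fun x => x + 1) = μ
  unit : ∀ k : ℤ, μ (triadic 0 k) = 1
  succ : ∀ (m : ℕ) (k : ℤ) (j : Fin 3),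
    μ (triadic (m + 1) (3 * k + (j : ℕ))) = p j * μ (triadic m k)

/-- Sum the integer translates of the self-similar measure. The triadic intervals are closed, so the
endpoints 0 and 1 must carry no mass; `p 0 < 1` and `p 2 < 1` ensure this. -/
theorem exists_isTriadic (p : Fin 3 → ℝ≥0∞) (hp : ∑ j, p j = 1) (h0 : p 0 < 1) (h2 : p 2 < 1) :
    ∃ μ, IsTriadic p μ := by
  obtain ⟨μ, hμ, hsupp, hself⟩ := exists_selfSimilar p hp
  have hz : ∀ A, A ⊆ (Icc (0 : ℝ) 1)ᶜ → μ A = 0 := fun A hA => measure_mono_null hA hsupp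
  have fixed_zero : ∀ c x : ℝ≥0∞, c < 1 → x ≠ ∞ → x = c * x → x = 0 := by
    intro c x hc hx h
    by_contra hx0
    have := (ENNReal.mul_lt_mul_iff_left hx0 hx).2 hc
    rw [one_mul, ← h] at this
    exact lt_irrefl _ this
  -- Among the preimages of 0 under the three contractions only 0 itself lies in `[0,1]`, so `μ {0}
  -- = p 0 * μ {0}`; likewise for 1 below.
  have hzero : μ {0} = 0 := by
    refine fixed_zero (p 0) _ h0 (measure_ne_top _ _) ?_
    conv_lhs => rw [hself _ (measurableSet_singleton 0), Fin.sum_univ_three]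
    have e0 : (fun x : ℝ => (x + ((0 : Fin 3) : ℕ)) / 3) ⁻¹' {0} = {0} := by ext x; simp
    rw [e0, hz ((fun x : ℝ => (x + ((1 : Fin 3) : ℕ)) / 3) ⁻¹' {0}),
      hz ((fun x : ℝ => (x + ((2 : Fin 3) : ℕ)) / 3) ⁻¹' {0})]
    · simp
    · rintro x hx ⟨h, -⟩; simp at hx; linarith
    · rintro x hx ⟨h, -⟩; simp at hx; linarith
  have hone : μ {1} = 0 := by
    refine fixed_zero (p 2) _ h2 (measure_ne_top _ _) ?_
    conv_lhs => rw [hself _ (measurableSet_singleton 1), Fin.sum_univ_three]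
    have e0 : (fun x : ℝ => (x + ((2 : Fin 3) : ℕ)) / 3) ⁻¹' {1} = {1} := by
      ext x; simp; constructor <;> intro h <;> linarith
    rw [e0, hz ((fun x : ℝ => (x + ((1 : Fin 3) : ℕ)) / 3) ⁻¹' {1}),
      hz ((fun x : ℝ => (x + ((0 : Fin 3) : ℕ)) / 3) ⁻¹' {1})]
    · simp
    · rintro x hx ⟨-, h⟩; simp at hx; linarith
    · rintro x hx ⟨-, h⟩; simp at hx; linarith
  have hout : ∀ (m : ℕ) (k : ℤ), k < 0 ∨ 3 ^ m ≤ k → μ (triadic m k) = 0 := by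
    intro m k hk
    have h3 : (0 : ℝ) < 3 ^ m := by positivity
    have hsub : triadic m k ⊆ {0} ∪ {1} ∪ (Icc (0 : ℝ) 1)ᶜ := by
      rintro x ⟨hx1, hx2⟩
      rw [div_le_iff₀ h3] at hx1
      rw [le_div_iff₀ h3] at hx2
      by_cases hx : x ∈ Icc (0 : ℝ) 1
      · left
        rcases hk with hk | hk
        · left
          have : (k : ℝ) + 1 ≤ 0 := by exact_mod_cast hk
          exact le_antisymm (by nlinarith) hx.1
        · right
          have : (3 : ℝ) ^ m ≤ k := by exact_mod_cast hk
          exact le_antisymm hx.2 (by nlinarith)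
      · right; exact hx
    exact measure_mono_null hsub (measure_union_null (measure_union_null hzero hone) hsupp)
  have hone' : μ (triadic 0 0) = 1 := by
    have : triadic 0 0 = Icc (0 : ℝ) 1 := by simp [triadic]
    rw [this]
    exact (prob_compl_eq_zero_iff measurableSet_Icc).1 hsupp
  have hrec : ∀ (m : ℕ) (k : ℤ), μ (triadic (m + 1) k) =
      ∑ i : Fin 3, p i * μ (triadic m (k - (i : ℕ) * 3 ^ m)) := by
    intro m k
    rw [hself _ (measurableSet_triadic _ _)]
    simp only [preimage_triadic_succ]
  have hsucc : ∀ (m : ℕ) (k : ℤ) (j : Fin 3),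
      μ (triadic (m + 1) (3 * k + (j : ℕ))) = p j * μ (triadic m k) := by
    intro m
    induction m with
    | zero =>
      intro k j
      rw [hrec, Fin.sum_univ_three]
      by_cases hk : k = 0
      · subst hk
        fin_cases j
        · simp [hone', hout 0 (-1) (by simp), hout 0 (-2) (by simp)]
        · simp [hone', hout 0 (-1) (by simp), hout 0 1 (by simp)]
        · simp [hone', hout 0 1 (by simp), hout 0 2 (by simp)]
      · rw [hout 0 _ (by simp; omega), hout 0 _ (by simp; omega), hout 0 _ (by simp; omega),
          hout 0 k (by simp; omega)]
        simp
    | succ m ih =>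
      intro k j
      -- `hrec` removes the outermost digit `i`, while the claim concerns the innermost digit `j`.
      -- Removing `i` shifts the index by a multiple of 3, so `j` is unaffected.
      rw [hrec, hrec, Finset.mul_sum]
      refine Finset.sum_congr rfl fun i _ => ?_
      have : 3 * k + ((j : ℕ) : ℤ) - ((i : ℕ) : ℤ) * 3 ^ (m + 1) =
          3 * (k - ((i : ℕ) : ℤ) * 3 ^ m) + ((j : ℕ) : ℤ) := by ring
      rw [this, ih]
      ring
  have hmeas : ∀ n : ℤ, Measurable fun x : ℝ => x + n := fun n => by fun_prop
  have hsum : ∀ (m : ℕ) (k : ℤ), Measure.sum (fun n : ℤ => μ.map fun x => x + (n : ℝ))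
      (triadic m k) = ∑' n : ℤ, μ (triadic m (k - n * 3 ^ m)) := by
    intro m k
    rw [Measure.sum_apply _ (measurableSet_triadic _ _)]
    refine tsum_congr fun n => ?_
    rw [Measure.map_apply (hmeas n) (measurableSet_triadic _ _), preimage_add_triadic]
  refine ⟨Measure.sum fun n : ℤ => μ.map fun x => x + (n : ℝ), ?_, ?_, ?_⟩
  · have hm1 : Measurable fun x : ℝ => x + 1 := by fun_prop
    rw [Measure.map_sum hm1.aemeasurable]
    have : (fun n : ℤ => (μ.map fun x => x + (n : ℝ)).map fun x => x + 1) =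
        (fun n : ℤ => μ.map fun x => x + (n : ℝ)) ∘ Equiv.addRight (1 : ℤ) := by
      funext n
      rw [Measure.map_map hm1 (hmeas n)]
      congr 1
      funext x
      simp [add_assoc]
    rw [this, Measure.sum_comp_equiv]
  · intro k
    rw [hsum, tsum_eq_single k]
    · simp [hone']
    · intro n hn
      refine hout 0 _ ?_
      simp only [pow_zero, mul_one]
      omega
  · intro m k j
    rw [hsum, hsum, ← ENNReal.tsum_mul_left]
    refine tsum_congr fun n => ?_
    have : 3 * k + ((j : ℕ) : ℤ) - n * 3 ^ (m + 1) = 3 * (k - n * 3 ^ m) + ((j : ℕ) : ℤ) := by ring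
    rw [this, hsucc]

/-! ### Cells at all scales and their regularity -/

/-- The half-open triadic interval of length `3 ^ m` and index `k`, at every scale `m : ℤ`. -/
def cell (m k : ℤ) : Set ℝ := Ico ((k : ℝ) * 3 ^ m) (((k : ℝ) + 1) * 3 ^ m)

lemma mem_cell_floor (m : ℤ) (x : ℝ) : x ∈ cell m ⌊x / 3 ^ m⌋ := by
  have h3 : (0 : ℝ) < 3 ^ m := by positivity
  rw [cell, mem_Ico, ← le_div_iff₀ h3, ← div_lt_iff₀ h3]
  exact ⟨Int.floor_le _, Int.lt_floor_add_one _⟩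

lemma exists_eq_three_mul_add (k : ℤ) : ∃ (l : ℤ) (j : Fin 3), k = 3 * l + ((j : ℕ) : ℤ) :=
  ⟨k / 3, ⟨(k % 3).toNat, by omega⟩, by simp only; omega⟩

lemma cell_succ (m k : ℤ) :
    cell (m + 1) k = cell m (3 * k) ∪ cell m (3 * k + 1) ∪ cell m (3 * k + 2) := by
  have h3 : (0 : ℝ) < 3 ^ m := by positivity
  have split : ∀ {a b c d : ℝ}, a ≤ b → b ≤ c → c ≤ d → Ico a d = Ico a b ∪ Ico b c ∪ Ico c d :=
    fun {a b c d} h1 h2 h3 => by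
      rw [Ico_union_Ico_eq_Ico h1 h2, Ico_union_Ico_eq_Ico (h1.trans h2) h3]
  simp only [cell]
  push_cast
  convert split (a := 3 * (k : ℝ) * 3 ^ m) (b := (3 * (k : ℝ) + 1) * 3 ^ m)
    (c := (3 * (k : ℝ) + 2) * 3 ^ m) (d := (3 * (k : ℝ) + 3) * 3 ^ m)
    (by nlinarith) (by nlinarith) (by nlinarith) using 2
  · rw [zpow_add_one₀ three_ne_zero]; ring
  · rw [zpow_add_one₀ three_ne_zero]; ring
  · rw [add_assoc (3 * (k : ℝ))]; norm_num
  · ring_nf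

lemma measurableSet_cell (m k : ℤ) : MeasurableSet (cell m k) := measurableSet_Ico

lemma measure_cell_succ (μ : Measure ℝ) (m k : ℤ) :
    μ (cell (m + 1) k) =
      μ (cell m (3 * k)) + μ (cell m (3 * k + 1)) + μ (cell m (3 * k + 2)) := by
  have hdisj : ∀ i j : ℤ, i + 1 ≤ j → Disjoint (cell m i) (cell m j) := by
    intro i j hij
    rw [cell, cell, Ico_disjoint_Ico]
    refine (min_le_left _ _).trans (le_trans ?_ (le_max_right _ _))
    gcongr
    exact_mod_cast hij
  rw [cell_succ, measure_union _ (measurableSet_cell _ _), measure_union _ (measurableSet_cell _ _)]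
  · exact hdisj _ _ (by omega)
  · exact disjoint_union_left.2 ⟨hdisj _ _ (by omega), hdisj _ _ (by omega)⟩

lemma cell_neg_subset_triadic (m : ℕ) (k : ℤ) : cell (-m) k ⊆ triadic m k := by
  rw [cell, triadic, zpow_neg, zpow_natCast, ← div_eq_mul_inv, ← div_eq_mul_inv]
  exact Ico_subset_Icc_self

lemma IsTriadic.measure_triadic_le {p : Fin 3 → ℝ≥0∞} {μ : Measure ℝ} (hμ : IsTriadic p μ)
    {q : ℝ≥0∞} (hq : ∀ j, p j ≤ q) (m : ℕ) (k : ℤ) : μ (triadic m k) ≤ q ^ m := by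
  induction m generalizing k with
  | zero => simp [hμ.unit]
  | succ m ih =>
    obtain ⟨l, j, rfl⟩ := exists_eq_three_mul_add k
    rw [hμ.succ, pow_succ']
    exact mul_le_mul' (hq j) (ih l)

lemma IsTriadic.nullSingletonClass {p : Fin 3 → ℝ≥0∞} {μ : Measure ℝ} (hμ : IsTriadic p μ)
    {q : ℝ≥0∞} (hq : ∀ j, p j ≤ q) (hq1 : q < 1) : NullSingletonClass μ := by
  refine ⟨fun x => ?_⟩
  refine le_antisymm (ge_of_tendsto' (ENNReal.tendsto_pow_atTop_nhds_zero_of_lt_one hq1)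
    fun m => ?_) zero_le
  refine (measure_mono ?_).trans (hμ.measure_triadic_le hq m ⌊x / 3 ^ (-m : ℤ)⌋)
  exact singleton_subset_iff.2 (cell_neg_subset_triadic _ _ (mem_cell_floor _ x))

lemma measure_cell_neg (μ : Measure ℝ) [NullSingletonClass μ] (m : ℕ) (k : ℤ) : μ (cell (-m) k) = μ (triadic m k) := by
  rw [cell, triadic, zpow_neg, zpow_natCast, ← div_eq_mul_inv, ← div_eq_mul_inv]
  exact measure_congr Ico_ae_eq_Icc

lemma IsTriadic.measure_cell_nat {p : Fin 3 → ℝ≥0∞} {μ : Measure ℝ} (hμ : IsTriadic p μ)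
    [NullSingletonClass μ] (m : ℕ) (k : ℤ) : μ (cell m k) = 3 ^ m := by
  induction m generalizing k with
  | zero => simpa [hμ.unit] using measure_cell_neg μ 0 k
  | succ m ih =>
    push_cast
    rw [measure_cell_succ, ih, ih, ih, pow_succ]
    ring

/-- Quantitative regularity of a measure on the triadic grid: neighbouring cells have comparable
masses, and a cell has at most the share `q` of the mass of its parent. -/
structure IsCellRegular (q : ℝ≥0∞) (R : ℝ≥0) (μ : Measure ℝ) : Prop where
  one_le : 1 ≤ R
  pos : ∀ m k, 0 < μ (cell m k)
  lt_top : ∀ m k, μ (cell m k) < ∞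
  le_right : ∀ m k, μ (cell m k) ≤ R * μ (cell m (k + 1))
  le_left : ∀ m k, μ (cell m (k + 1)) ≤ R * μ (cell m k)
  child : ∀ (m k : ℤ) (j : Fin 3), μ (cell m (3 * k + (j : ℕ))) ≤ q * μ (cell (m + 1) k)

/-- Adjacent intervals with a common parent compare by the ratio of weights. Otherwise they are
outer thirds of adjacent parents, and since `p 0 = p 2` they inherit the ratio of the parents: no
factor accumulates with the generation. -/
lemma IsTriadic.neighbour {p : Fin 3 → ℝ≥0∞} {μ : Measure ℝ} (hμ : IsTriadic p μ) {R : ℝ≥0}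
    (hR : 1 ≤ R) (h02 : p 0 = p 2) (h01 : p 0 ≤ R * p 1) (h10 : p 1 ≤ R * p 0) (m : ℕ) (k : ℤ) :
    μ (triadic m k) ≤ R * μ (triadic m (k + 1)) ∧ μ (triadic m (k + 1)) ≤ R * μ (triadic m k) := by
  induction m generalizing k with
  | zero => simp [hμ.unit, hR]
  | succ m ih =>
    obtain ⟨l, j, rfl⟩ := exists_eq_three_mul_add k
    have e0 := hμ.succ m l 0
    have e1 := hμ.succ m l 1
    have e2 := hμ.succ m l 2
    have e3 := hμ.succ m (l + 1) 0
    have key : ∀ {a b x : ℝ≥0∞}, a ≤ R * b → a * x ≤ R * (b * x) := fun {a b x} h => by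
      rw [← mul_assoc]; gcongr
    have key' : ∀ {a x y : ℝ≥0∞}, x ≤ R * y → a * x ≤ R * (a * y) := fun {a x y} h => by
      rw [mul_left_comm]; gcongr
    fin_cases j
    · simp only [Fin.val_zero, Fin.val_one, Nat.cast_zero, Nat.cast_one] at e0 e1
      simp only [Nat.cast_zero]
      rw [e0, add_zero, e1]
      exact ⟨key h01, key h10⟩
    · simp only [Fin.val_one, Fin.val_two, Nat.cast_ofNat, Nat.cast_one] at e1 e2
      simp only [Nat.cast_one]
      rw [e1, show 3 * l + 1 + 1 = 3 * l + 2 by ring, e2, ← h02]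
      exact ⟨key h10, key h01⟩
    · simp only [Fin.val_zero, Fin.val_two, Nat.cast_ofNat, Nat.cast_zero, add_zero] at e2 e3
      simp only [Nat.cast_ofNat]
      rw [e2, show 3 * l + 2 + 1 = 3 * (l + 1) by ring, e3, ← h02]
      exact ⟨key' (ih l).1, key' (ih l).2⟩

theorem IsTriadic.isCellRegular {p : Fin 3 → ℝ≥0∞} {μ : Measure ℝ} (hμ : IsTriadic p μ)
    {q : ℝ≥0∞} {R : ℝ≥0} (hq : ∀ j, p j ≤ q) (hq1 : q < 1) (hq3 : 1 ≤ 3 * q)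
    (hp : ∀ j, 0 < p j)
    (hR : 1 ≤ R) (h02 : p 0 = p 2) (h01 : p 0 ≤ R * p 1) (h10 : p 1 ≤ R * p 0) :
    IsCellRegular q R μ := by
  have := hμ.nullSingletonClass hq hq1
  have hpos : ∀ (m : ℕ) k, 0 < μ (triadic m k) := by
    intro m
    induction m with
    | zero => simp [hμ.unit]
    | succ m ih =>
      intro k
      obtain ⟨l, j, rfl⟩ := exists_eq_three_mul_add k
      rw [hμ.succ]
      exact ENNReal.mul_pos (hp j).ne' (ih l).ne'
  refine ⟨hR, ?_, ?_, ?_, ?_, ?_⟩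
  · intro m k
    obtain ⟨n, rfl | rfl⟩ := m.eq_nat_or_neg
    · rw [hμ.measure_cell_nat]; positivity
    · rw [measure_cell_neg]; exact hpos n k
  · intro m k
    obtain ⟨n, rfl | rfl⟩ := m.eq_nat_or_neg
    · rw [hμ.measure_cell_nat]; exact ENNReal.pow_lt_top (by simp)
    · rw [measure_cell_neg]
      exact (hμ.measure_triadic_le hq n k).trans_lt
        (ENNReal.pow_lt_top (hq1.trans ENNReal.one_lt_top))
  · intro m k
    obtain ⟨n, rfl | rfl⟩ := m.eq_nat_or_neg
    · rw [hμ.measure_cell_nat, hμ.measure_cell_nat]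
      exact le_mul_of_one_le_left zero_le (by exact_mod_cast hR)
    · rw [measure_cell_neg, measure_cell_neg]
      exact (hμ.neighbour hR h02 h01 h10 n k).1
  · intro m k
    obtain ⟨n, rfl | rfl⟩ := m.eq_nat_or_neg
    · rw [hμ.measure_cell_nat, hμ.measure_cell_nat]
      exact le_mul_of_one_le_left zero_le (by exact_mod_cast hR)
    · rw [measure_cell_neg, measure_cell_neg]
      exact (hμ.neighbour hR h02 h01 h10 n k).2
  · intro m k j
    -- From unit scale upwards a child has exactly one third of its parent's mass, whence the
    -- requirement `1 ≤ 3 * q`.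
    rcases le_or_gt 0 m with h | h
    · lift m to ℕ using h
      rw [hμ.measure_cell_nat, show (m : ℤ) + 1 = ((m + 1 : ℕ) : ℤ) by push_cast; rfl,
        hμ.measure_cell_nat, pow_succ]
      calc (3 : ℝ≥0∞) ^ m = 3 ^ m * 1 := (mul_one _).symm
        _ ≤ 3 ^ m * (3 * q) := by gcongr
        _ = q * (3 ^ m * 3) := by ring
    · obtain ⟨n, rfl⟩ : ∃ n : ℕ, m = -((n + 1 : ℕ) : ℤ) := ⟨(-m - 1).toNat, by omega⟩
      rw [measure_cell_neg, hμ.succ, show -((n + 1 : ℕ) : ℤ) + 1 = -(n : ℤ) by push_cast; ring,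
        measure_cell_neg]
      exact mul_le_mul_left (hq j) _

/-! ### From cells to arbitrary intervals: doubling and mass decay -/

lemma Icc_subset_dbl {a b : ℝ} (hab : a < b) : Icc a b ⊆ dbl a b :=
  Icc_subset_Icc (by linarith) (by linarith)

lemma floor_eq_of_mem_cell {m k : ℤ} {x : ℝ} (hx : x ∈ cell m k) : ⌊x / 3 ^ m⌋ = k := by
  have h3 : (0 : ℝ) < 3 ^ m := by positivity
  rw [Int.floor_eq_iff, le_div_iff₀ h3, div_lt_iff₀ h3]
  exact hx

lemma cell_subset_cell_succ (m k : ℤ) (j : Fin 3) :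
    cell m (3 * k + (j : ℕ)) ⊆ cell (m + 1) k := by
  rw [cell_succ]
  fin_cases j
  · simpa using (subset_union_left.trans subset_union_left)
  · exact subset_union_right.trans subset_union_left
  · exact subset_union_right

lemma exists_cell_subset_Icc {a b : ℝ} (hab : a < b) :
    ∃ m k : ℤ, b - a < 6 * 3 ^ m ∧ cell m k ⊆ Icc a b ∧
      ∀ x ∈ dbl a b, |⌊x / 3 ^ m⌋ - k| ≤ 12 := by
  -- With `2 * 3 ^ m ≤ b - a < 6 * 3 ^ m`, the first cell starting after `a` ends before `b`. The
  -- doubled interval has length below `12 * 3 ^ m`, which bounds the index distance.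
  obtain ⟨m, hm1, hm2⟩ := exists_mem_Ico_zpow (x := (b - a) / 2) (y := (3 : ℝ)) (by linarith)
    (by norm_num)
  rw [zpow_add_one₀ three_ne_zero] at hm2
  have h3 : (0 : ℝ) < 3 ^ m := by positivity
  have f1 := Int.floor_le (a / 3 ^ m)
  have f2 := Int.lt_floor_add_one (a / 3 ^ m)
  rw [le_div_iff₀ h3] at f1
  rw [div_lt_iff₀ h3] at f2
  refine ⟨m, ⌊a / 3 ^ m⌋ + 1, by linarith, ?_, ?_⟩
  · refine (Ico_subset_Icc_self).trans (Icc_subset_Icc ?_ ?_)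
    · push_cast; linarith
    · push_cast; linarith
  · rintro x ⟨hx1, hx2⟩
    have e1 := Int.floor_le (x / 3 ^ m)
    have e2 := Int.lt_floor_add_one (x / 3 ^ m)
    rw [le_div_iff₀ h3] at e1
    rw [div_lt_iff₀ h3] at e2
    have u : (⌊x / 3 ^ m⌋ : ℝ) < ⌊a / 3 ^ m⌋ + 12 := by
      refine lt_of_mul_lt_mul_right ?_ h3.le
      linarith
    have l : (⌊a / 3 ^ m⌋ : ℝ) < ⌊x / 3 ^ m⌋ + 6 := by
      refine lt_of_mul_lt_mul_right ?_ h3.le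
      linarith
    have u' : ⌊x / 3 ^ m⌋ < ⌊a / 3 ^ m⌋ + 12 := by exact_mod_cast u
    have l' : ⌊a / 3 ^ m⌋ < ⌊x / 3 ^ m⌋ + 6 := by exact_mod_cast l
    rw [abs_le]
    constructor <;> linarith

namespace IsCellRegular

variable {q : ℝ≥0∞} {R : ℝ≥0} {μ : Measure ℝ}

lemma measure_cell_add_le (hμ : IsCellRegular q R μ) (m k : ℤ) (n : ℕ) :
    μ (cell m (k + n)) ≤ (R : ℝ≥0∞) ^ n * μ (cell m k) := by
  induction n with
  | zero => simp
  | succ n ih =>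
    push_cast
    rw [← add_assoc, pow_succ', mul_assoc]
    exact (hμ.le_left m _).trans (mul_le_mul_right ih _)

lemma measure_cell_sub_le (hμ : IsCellRegular q R μ) (m k : ℤ) (n : ℕ) :
    μ (cell m (k - n)) ≤ (R : ℝ≥0∞) ^ n * μ (cell m k) := by
  induction n with
  | zero => simp
  | succ n ih =>
    have := hμ.le_right m (k - (n + 1))
    rw [show k - ((n : ℤ) + 1) + 1 = k - n by ring] at this
    push_cast
    rw [pow_succ', mul_assoc]
    exact this.trans (mul_le_mul_right ih _)

lemma measure_cell_le_of_abs_le (hμ : IsCellRegular q R μ) {m k l : ℤ} {N : ℕ}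
    (h : |l - k| ≤ N) : μ (cell m l) ≤ (R : ℝ≥0∞) ^ N * μ (cell m k) := by
  have hR : (1 : ℝ≥0∞) ≤ R := by exact_mod_cast hμ.one_le
  rw [abs_le] at h
  have hle : ∀ n : ℕ, n ≤ N → (R : ℝ≥0∞) ^ n * μ (cell m k) ≤ (R : ℝ≥0∞) ^ N * μ (cell m k) :=
    fun n hn => mul_le_mul_left (pow_le_pow_right₀ hR hn) _
  obtain ⟨n, hn | hn⟩ := (l - k).eq_nat_or_neg
  · rw [show l = k + n by omega]
    exact (hμ.measure_cell_add_le m k n).trans (hle n (by omega))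
  · rw [show l = k - n by omega]
    exact (hμ.measure_cell_sub_le m k n).trans (hle n (by omega))

lemma measure_dbl_le_cell (hμ : IsCellRegular q R μ) {a b : ℝ} {m k : ℤ}
    (h : ∀ x ∈ dbl a b, |⌊x / 3 ^ m⌋ - k| ≤ 12) :
    μ (dbl a b) ≤ 25 * R ^ 12 * μ (cell m k) := by
  have hsub : dbl a b ⊆ ⋃ i ∈ Finset.Icc (k - 12) (k + 12), cell m i := by
    intro x hx
    have := h x hx
    rw [abs_le] at this
    simp only [mem_iUnion, Finset.mem_Icc]
    exact ⟨⌊x / 3 ^ m⌋, ⟨by omega, by omega⟩, mem_cell_floor m x⟩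
  calc μ (dbl a b) ≤ ∑ i ∈ Finset.Icc (k - 12) (k + 12), μ (cell m i) :=
        (measure_mono hsub).trans (measure_biUnion_finset_le _ _)
    _ ≤ ∑ i ∈ Finset.Icc (k - 12) (k + 12), (R : ℝ≥0∞) ^ 12 * μ (cell m k) := by
        refine Finset.sum_le_sum fun i hi => hμ.measure_cell_le_of_abs_le ?_
        rw [Finset.mem_Icc] at hi
        rw [abs_le]
        constructor <;> push_cast <;> omega
    _ = 25 * R ^ 12 * μ (cell m k) := by
        rw [Finset.sum_const, Int.card_Icc, show (k + 12 + 1 - (k - 12)).toNat = 25 by omega,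
          nsmul_eq_mul, mul_assoc]
        norm_num

lemma measure_dbl_le (hμ : IsCellRegular q R μ) {a b : ℝ} (hab : a < b) :
    μ (dbl a b) ≤ 25 * R ^ 12 * μ (Icc a b) := by
  obtain ⟨m, k, -, hk, h⟩ := exists_cell_subset_Icc hab
  exact (hμ.measure_dbl_le_cell h).trans (by gcongr)

lemma measure_dbl_lt_top (hμ : IsCellRegular q R μ) {a b : ℝ} (hab : a < b) :
    μ (dbl a b) < ∞ := by
  obtain ⟨m, k, -, hk, h⟩ := exists_cell_subset_Icc hab
  refine (hμ.measure_dbl_le_cell h).trans_lt (ENNReal.mul_lt_top ?_ (hμ.lt_top m k))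
  exact ENNReal.mul_lt_top (by simp) (ENNReal.pow_lt_top (by simp))

lemma isLocallyFiniteMeasure (hμ : IsCellRegular q R μ) : IsLocallyFiniteMeasure μ := by
  refine ⟨fun x => ⟨Icc (x - 1) (x + 1), Icc_mem_nhds (by linarith) (by linarith), ?_⟩⟩
  exact (measure_mono (Icc_subset_dbl (by linarith))).trans_lt
    (hμ.measure_dbl_lt_top (by linarith))

lemma isDoubling (hμ : IsCellRegular q R μ) : IsDoubling μ := by
  refine ⟨fun h => ?_, 25 * R ^ 12, fun a b hab => ?_⟩
  · have := hμ.pos 0 0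
    simp [h] at this
  · push_cast
    exact hμ.measure_dbl_le hab

lemma measure_cell_floor_le (hμ : IsCellRegular q R μ) (m : ℤ) (n : ℕ) (x : ℝ) :
    μ (cell (m - n) ⌊x / 3 ^ (m - n)⌋) ≤ q ^ n * μ (cell m ⌊x / 3 ^ m⌋) := by
  induction n with
  | zero => simp
  | succ n ih =>
    set m' : ℤ := m - (n + 1 : ℕ) with hm'
    have e : m - (n : ℤ) = m' + 1 := by rw [hm']; push_cast; ring
    rw [e] at ih
    obtain ⟨l, j, hl⟩ := exists_eq_three_mul_add ⌊x / 3 ^ m'⌋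
    have hx := mem_cell_floor m' x
    rw [hl] at hx ⊢
    rw [floor_eq_of_mem_cell (cell_subset_cell_succ _ _ _ hx)] at ih
    rw [pow_succ', mul_assoc]
    exact (hμ.child m' l j).trans (mul_le_mul_right ih _)

/-- The ball meets at most three cells of its scale. Each of these that meets `I` has lost a factor
`q ^ n` against its ancestor at scale `m`, which is within 12 steps of the cell `k` inside `I`. The
centre `y` may lie anywhere. -/
lemma measure_Icc_inter_closedBall_le (hμ : IsCellRegular q R μ) {a b : ℝ} {m k : ℤ}
    (hk : cell m k ⊆ Icc a b) (h : ∀ x ∈ Icc a b, |⌊x / 3 ^ m⌋ - k| ≤ 12) (y : ℝ) (n : ℕ) :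
    μ (Icc a b ∩ Metric.closedBall y (3 ^ (m - n : ℤ))) ≤ 3 * R ^ 12 * q ^ n * μ (Icc a b) := by
  set m' : ℤ := m - n with hm'
  have h3 : (0 : ℝ) < 3 ^ m' := by positivity
  set l := ⌊y / 3 ^ m'⌋ with hl
  have hsub : Icc a b ∩ Metric.closedBall y (3 ^ m') ⊆
      ⋃ i ∈ Finset.Icc (l - 1) (l + 1), Icc a b ∩ cell m' i := by
    rintro x ⟨hx, hxy⟩
    rw [Metric.mem_closedBall, Real.dist_eq, abs_le] at hxy
    have e1 := Int.floor_le (x / 3 ^ m')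
    have e2 := Int.lt_floor_add_one (x / 3 ^ m')
    have f1 := Int.floor_le (y / 3 ^ m')
    have f2 := Int.lt_floor_add_one (y / 3 ^ m')
    have g1 : x / 3 ^ m' ≤ y / 3 ^ m' + 1 := by
      rw [div_add_one h3.ne']; gcongr; linarith
    have g2 : y / 3 ^ m' ≤ x / 3 ^ m' + 1 := by
      rw [div_add_one h3.ne']; gcongr; linarith
    have u : (⌊x / 3 ^ m'⌋ : ℝ) < l + 2 := by linarith
    have v : (l : ℝ) < ⌊x / 3 ^ m'⌋ + 2 := by linarith
    have u' : ⌊x / 3 ^ m'⌋ < l + 2 := by exact_mod_cast u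
    have v' : l < ⌊x / 3 ^ m'⌋ + 2 := by exact_mod_cast v
    simp only [mem_iUnion, Finset.mem_Icc]
    exact ⟨⌊x / 3 ^ m'⌋, ⟨by omega, by omega⟩, hx, mem_cell_floor m' x⟩
  have hcell : ∀ i, μ (Icc a b ∩ cell m' i) ≤ R ^ 12 * q ^ n * μ (Icc a b) := by
    intro i
    rcases (Icc a b ∩ cell m' i).eq_empty_or_nonempty with he | ⟨x, hx, hxi⟩
    · simp [he]
    · calc μ (Icc a b ∩ cell m' i) ≤ μ (cell m' i) := measure_mono inter_subset_right
        _ ≤ q ^ n * μ (cell m ⌊x / 3 ^ m⌋) := by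
            rw [← floor_eq_of_mem_cell hxi]; exact hμ.measure_cell_floor_le m n x
        _ ≤ q ^ n * (R ^ 12 * μ (cell m k)) := by
            gcongr; exact hμ.measure_cell_le_of_abs_le (h x hx)
        _ ≤ q ^ n * (R ^ 12 * μ (Icc a b)) := by gcongr
        _ = R ^ 12 * q ^ n * μ (Icc a b) := by ring
  calc _ ≤ ∑ i ∈ Finset.Icc (l - 1) (l + 1), μ (Icc a b ∩ cell m' i) :=
        (measure_mono hsub).trans (measure_biUnion_finset_le _ _)
    _ ≤ ∑ i ∈ Finset.Icc (l - 1) (l + 1), R ^ 12 * q ^ n * μ (Icc a b) :=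
        Finset.sum_le_sum fun i _ => hcell i
    _ = 3 * R ^ 12 * q ^ n * μ (Icc a b) := by
        rw [Finset.sum_const, Int.card_Icc, show (l + 1 + 1 - (l - 1)).toNat = 3 by omega,
          nsmul_eq_mul]
        push_cast
        ring

end IsCellRegular

/-! ### Riesz potentials of the measure -/

lemma ofReal_zpow_sub_rpow_neg (m : ℤ) (n : ℕ) (β : ℝ) :
    ENNReal.ofReal (3 ^ (m - n : ℤ)) ^ (-β) =
      ENNReal.ofReal (3 ^ m) ^ (-β) * ((3 : ℝ≥0∞) ^ β) ^ n := by
  have h3 : (3 : ℝ≥0∞) = ENNReal.ofReal 3 := by simp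
  rw [h3, ENNReal.ofReal_rpow_of_pos (by positivity), ENNReal.ofReal_rpow_of_pos (by positivity),
    ENNReal.ofReal_rpow_of_pos (by positivity), ← ENNReal.ofReal_pow (by positivity),
    ← ENNReal.ofReal_mul (by positivity)]
  congr 1
  rw [← Real.rpow_intCast, ← Real.rpow_intCast, ← Real.rpow_natCast, ← Real.rpow_mul (by norm_num),
    ← Real.rpow_mul (by norm_num), ← Real.rpow_mul (by norm_num), ← Real.rpow_add (by norm_num)]
  congr 1
  push_cast
  ring

lemma ennreal_rpow_neg_le_rpow_neg {β : ℝ} (hβ : 0 ≤ β) {x y : ℝ≥0∞} (h : x ≤ y) :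
    y ^ (-β) ≤ x ^ (-β) := by
  rw [ENNReal.rpow_neg, ENNReal.rpow_neg, ENNReal.inv_le_inv]
  exact ENNReal.rpow_le_rpow h hβ

lemma kernel_le_tsum {β : ℝ} (hβ : 0 < β) (m : ℤ) {x y : ℝ} (hxy : x ≠ y) :
    ENNReal.ofReal |x - y| ^ (-β) ≤ ENNReal.ofReal (3 ^ m) ^ (-β) +
      ∑' n : ℕ, (Metric.closedBall y (3 ^ (m - n : ℤ))).indicator
        (fun _ => ENNReal.ofReal (3 ^ m) ^ (-β) * ((3 : ℝ≥0∞) ^ β) ^ (n + 1)) x := by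
  rcases le_or_gt ((3 : ℝ) ^ m) |x - y| with h | h
  · refine le_add_right ?_
    exact ennreal_rpow_neg_le_rpow_neg hβ.le (ENNReal.ofReal_le_ofReal h)
  · refine le_add_left ?_
    have hpos : 0 < |x - y| := abs_pos.2 (sub_ne_zero.2 hxy)
    obtain ⟨i, hi1, hi2⟩ := exists_mem_Ico_zpow hpos (by norm_num : (1 : ℝ) < 3)
    have him : i < m := by
      by_contra! hc
      exact absurd (hi1.trans_lt h) (not_lt.2 (zpow_le_zpow_right₀ (by norm_num) hc))
    -- The lower bound `3 ^ i` on the distance controls the kernel, the upper bound `3 ^ (i + 1)`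
    -- puts `x` in the ball; hence power `n + 1` with radius `3 ^ (m - n)`.
    obtain ⟨n, rfl⟩ : ∃ n : ℕ, i = m - (n + 1 : ℕ) := ⟨(m - i - 1).toNat, by omega⟩
    refine le_trans ?_ (ENNReal.le_tsum n)
    rw [indicator_of_mem, ← ofReal_zpow_sub_rpow_neg]
    · exact ennreal_rpow_neg_le_rpow_neg hβ.le (ENNReal.ofReal_le_ofReal hi1)
    · rw [Metric.mem_closedBall, Real.dist_eq]
      refine hi2.le.trans (le_of_eq ?_)
      congr 1
      push_cast
      ring

theorem IsCellRegular.exists_potential_le {q : ℝ≥0∞} {R : ℝ≥0} {μ : Measure ℝ}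
    [NullSingletonClass μ] (hμ : IsCellRegular q R μ) {β : ℝ} (hβ : 0 < β) (hq : 3 ^ β * q < 1) :
    ∃ C : ℝ≥0, ∀ a b : ℝ, a < b → ∀ y : ℝ,
      ∫⁻ x in Icc a b, ENNReal.ofReal |x - y| ^ (-β) ∂μ ≤
        C * ENNReal.ofReal (2 * (b - a)) ^ (-β) * μ (Icc a b) := by
  set t : ℝ≥0∞ := 3 ^ β with ht
  -- The factor in 12 converts `3 ^ m` into `2 * (b - a) < 12 * 3 ^ m`; the rest is the far part of
  -- the kernel plus the geometric series of ratio `t * q`.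
  set D : ℝ≥0∞ := (12⁻¹) ^ (-β) * (1 + 3 * R ^ 12 * t * (1 - t * q)⁻¹) with hD
  have ht_top : t ≠ ∞ := ENNReal.rpow_ne_top_of_nonneg hβ.le (by simp)
  have hDtop : D ≠ ∞ := by
    have h1 : (12⁻¹ : ℝ≥0∞) ^ (-β) ≠ ∞ := by
      rw [ENNReal.rpow_neg, ENNReal.inv_rpow, inv_inv]
      exact ENNReal.rpow_ne_top_of_nonneg hβ.le (by simp)
    have h2 : (1 - t * q)⁻¹ ≠ ∞ := ENNReal.inv_ne_top.2 (tsub_pos_of_lt hq).ne'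
    have h3 : (3 * (R : ℝ≥0∞) ^ 12) ≠ ∞ := ENNReal.mul_ne_top (by simp) (by simp)
    exact ENNReal.mul_ne_top h1
      (ENNReal.add_ne_top.2 ⟨by simp, ENNReal.mul_ne_top (ENNReal.mul_ne_top h3 ht_top) h2⟩)
  refine ⟨D.toNNReal, fun a b hab y => ?_⟩
  rw [ENNReal.coe_toNNReal hDtop]
  obtain ⟨m, k, hm, hk, h⟩ := exists_cell_subset_Icc hab
  set H : ℝ≥0∞ := ENNReal.ofReal (3 ^ m) ^ (-β) with hH
  -- The kernel is infinite at `x = y`, a point of zero mass.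
  have hae : ∀ᵐ x ∂μ.restrict (Icc a b), x ≠ y := by
    refine ae_restrict_of_ae ?_
    rw [ae_iff]
    simp
  have hmeas : ∀ n : ℕ, MeasurableSet (Metric.closedBall y ((3 : ℝ) ^ (m - n : ℤ))) :=
    fun n => measurableSet_closedBall
  have hHle : H ≤ ENNReal.ofReal (2 * (b - a)) ^ (-β) * (12⁻¹) ^ (-β) := by
    rw [← ENNReal.mul_rpow_of_ne_zero (by simpa using hab) (by simp)]
    refine ennreal_rpow_neg_le_rpow_neg hβ.le ?_
    rw [← div_eq_mul_inv]
    refine ENNReal.div_le_of_le_mul ?_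
    rw [show (12 : ℝ≥0∞) = ENNReal.ofReal 12 by simp, ← ENNReal.ofReal_mul (by positivity)]
    exact ENNReal.ofReal_le_ofReal (by linarith)
  calc ∫⁻ x in Icc a b, ENNReal.ofReal |x - y| ^ (-β) ∂μ
      ≤ ∫⁻ x in Icc a b, (H + ∑' n : ℕ, (Metric.closedBall y (3 ^ (m - n : ℤ))).indicator
          (fun _ => H * t ^ (n + 1)) x) ∂μ := by
        refine lintegral_mono_ae ?_
        filter_upwards [hae] with x hx
        exact kernel_le_tsum hβ m hx
    _ = H * μ (Icc a b) + ∑' n : ℕ, H * t ^ (n + 1) *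
          μ (Icc a b ∩ Metric.closedBall y (3 ^ (m - n : ℤ))) := by
        rw [lintegral_add_left measurable_const, lintegral_const, Measure.restrict_apply_univ,
          lintegral_tsum fun n => (measurable_const.indicator (hmeas n)).aemeasurable]
        congr 1
        refine tsum_congr fun n => ?_
        rw [lintegral_indicator_const (hmeas n), Measure.restrict_apply (hmeas n), inter_comm]
    _ ≤ H * μ (Icc a b) + ∑' n : ℕ, H * t ^ (n + 1) * (3 * R ^ 12 * q ^ n * μ (Icc a b)) := by
        gcongr with n
        exact hμ.measure_Icc_inter_closedBall_le hk (fun x hx => h x (Icc_subset_dbl hab hx)) y n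
    _ = H * ((1 + 3 * R ^ 12 * t * (1 - t * q)⁻¹) * μ (Icc a b)) := by
        rw [← ENNReal.tsum_geometric, ← ENNReal.tsum_mul_left, add_mul, one_mul, mul_add,
          ← ENNReal.tsum_mul_right, ← ENNReal.tsum_mul_left]
        congr 1
        refine tsum_congr fun n => ?_
        rw [mul_pow]
        ring
    _ ≤ ENNReal.ofReal (2 * (b - a)) ^ (-β) * (12⁻¹) ^ (-β) *
          ((1 + 3 * R ^ 12 * t * (1 - t * q)⁻¹) * μ (Icc a b)) := by gcongr
    _ = D * ENNReal.ofReal (2 * (b - a)) ^ (-β) * μ (Icc a b) := by rw [hD]; ring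

/-! ### Duality between potentials and capacity -/

/-- Integrate the constraint `I_α h ≥ X` over `E` against `μ`, exchange the integrals, and bound the
inner potential of `μ` uniformly in `y`. -/
theorem measure_div_le_mul_relCap {μ : Measure ℝ} [SFinite μ] {α a b : ℝ} (hab : a < b)
    {D : ℝ≥0} (hD : 0 < D)
    (hpot : ∀ y, ∫⁻ x in Icc a b, ENNReal.ofReal |x - y| ^ (α - 1) ∂μ ≤
      D * ENNReal.ofReal (2 * (b - a)) ^ (α - 1) * μ (dbl a b))
    {E : Set ℝ} (hE : MeasurableSet E) (hEI : E ⊆ Icc a b) :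
    μ E / μ (dbl a b) ≤ D * relCap α E a b := by
  set X : ℝ≥0∞ := ENNReal.ofReal (2 * (b - a)) ^ (α - 1) with hX
  have hb : 0 < ENNReal.ofReal (2 * (b - a)) := by simpa using hab
  have hX0 : X ≠ 0 := (ENNReal.rpow_pos hb ENNReal.ofReal_ne_top).ne'
  have hXtop : X ≠ ∞ := ENNReal.rpow_ne_top_of_ne_zero hb.ne' ENNReal.ofReal_ne_top
  have main : ∀ h : ℝ → ℝ≥0∞, Measurable h → (∀ x ∈ E, X ≤ rieszPotential α h x) →
      μ E / μ (dbl a b) ≤ D * ∫⁻ x, h x := by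
    intro h hh hle
    refine ENNReal.div_le_of_le_mul ?_
    rw [← ENNReal.mul_le_mul_iff_right hX0 hXtop]
    calc X * μ E = ∫⁻ _ in E, X ∂μ := by
          rw [lintegral_const, Measure.restrict_apply_univ]
      _ ≤ ∫⁻ x in E, (∫⁻ y, ENNReal.ofReal |x - y| ^ (α - 1) * h y) ∂μ :=
          setLIntegral_mono' hE hle
      _ = ∫⁻ y, ∫⁻ x in E, ENNReal.ofReal |x - y| ^ (α - 1) * h y ∂μ := by
          refine lintegral_lintegral_swap (Measurable.aemeasurable ?_)
          simp only [Function.uncurry_def]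
          fun_prop
      _ = ∫⁻ y, (∫⁻ x in E, ENNReal.ofReal |x - y| ^ (α - 1) ∂μ) * h y := by
          refine lintegral_congr fun y => ?_
          exact lintegral_mul_const _ (by fun_prop)
      _ ≤ ∫⁻ y, (D * X * μ (dbl a b)) * h y := by
          refine lintegral_mono fun y => mul_le_mul_left ?_ _
          exact (lintegral_mono_set hEI).trans (hpot y)
      _ = X * (D * (∫⁻ x, h x) * μ (dbl a b)) := by
          rw [lintegral_const_mul _ hh]
          ring
  rw [← ENNReal.div_le_iff' (by simpa using hD.ne') ENNReal.coe_ne_top]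
  refine le_sInf ?_
  rintro _ ⟨h, hh, -, hle, rfl⟩
  rw [ENNReal.div_le_iff' (by simpa using hD.ne') ENNReal.coe_ne_top]
  exact main h hh hle

lemma measure_div_le_one_of_subset {μ : Measure ℝ} {E F : Set ℝ} (h : E ⊆ F) : μ E / μ F ≤ 1 :=
  ENNReal.div_le_of_le_mul (by rw [one_mul]; exact measure_mono h)

theorem isFracAInftyWith_min {μ : Measure ℝ} [IsLocallyFiniteMeasure μ] {α : ℝ} {D : ℝ≥0}
    (hD : 0 < D)
    (hpot : ∀ a b : ℝ, a < b → ∀ y, ∫⁻ x in Icc a b, ENNReal.ofReal |x - y| ^ (α - 1) ∂μ ≤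
      D * ENNReal.ofReal (2 * (b - a)) ^ (α - 1) * μ (dbl a b)) :
    IsFracAInftyWith α (fun t => min (D * t) 1) μ := by
  refine ⟨inferInstance, fun t _ => ⟨zero_le, min_le_right _ _⟩, ?_, ?_⟩
  · have : Continuous fun t : ℝ≥0∞ => min ((D : ℝ≥0∞) * t) 1 :=
      (ENNReal.continuous_const_mul ENNReal.coe_ne_top).min continuous_const
    simpa using (this.tendsto 0).mono_left (nhdsWithin_le_nhds (s := Icc 0 1))
  · intro a b hab _ E hE hEI
    exact le_min (measure_div_le_mul_relCap hab hD (hpot a b hab) hE.measurableSet hEI)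
      (measure_div_le_one_of_subset (hEI.trans (Icc_subset_dbl hab)))

theorem isFracAInftyWith_id {μ : Measure ℝ} [IsLocallyFiniteMeasure μ] {α : ℝ}
    (hpot : ∀ a b : ℝ, a < b → ∀ y, ∫⁻ x in Icc a b, ENNReal.ofReal |x - y| ^ (α - 1) ∂μ ≤
      ENNReal.ofReal (2 * (b - a)) ^ (α - 1) * μ (dbl a b)) :
    IsFracAInftyWith α (fun t => t) μ := by
  refine ⟨inferInstance, fun t ht => ht, tendsto_id.mono_left nhdsWithin_le_nhds, ?_⟩
  intro a b hab _ E hE hEI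
  have := measure_div_le_mul_relCap (D := 1) hab one_pos
    (fun y => by simpa using hpot a b hab y) hE.measurableSet hEI
  simpa using this

/-! ### Reverse doubling and the sharp constant -/

lemma measure_Icc_two_pow_le {μ : Measure ℝ} {K : ℝ≥0}
    (hK : ∀ a b : ℝ, a < b → μ (dbl a b) ≤ K * μ (Icc a b)) (c : ℝ) {r : ℝ} (hr : 0 < r) (n : ℕ) :
    μ (Icc (c - 2 ^ n * r) (c + 2 ^ n * r)) ≤ (K : ℝ≥0∞) ^ n * μ (Icc (c - r) (c + r)) := by
  induction n with
  | zero => simp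
  | succ n ih =>
    have hn : 0 < (2 : ℝ) ^ n * r := by positivity
    have := hK (c - 2 ^ n * r) (c + 2 ^ n * r) (by linarith)
    rw [pow_succ' (K : ℝ≥0∞), mul_assoc]
    refine le_trans (measure_mono (Icc_subset_Icc ?_ ?_)) (this.trans (mul_le_mul_right ih _))
    · rw [pow_succ']; linarith
    · rw [pow_succ']; linarith

/-- Reverse doubling: a short interval in the right-hand part of `2I`, disjoint from `I`, carries a
fixed share of `μ(2I)`, since four doublings of it cover `2I`. -/
lemma IsDoubling.exists_measure_Icc_le {μ : Measure ℝ} [IsLocallyFiniteMeasure μ]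
    (hμ : IsDoubling μ) : ∃ γ : ℝ≥0, 0 < γ ∧ γ < 1 ∧
      ∀ a b : ℝ, a < b → μ (Icc a b) ≤ γ * μ (dbl a b) := by
  obtain ⟨K, hK⟩ := hμ.2
  -- `K ^ 4` pays for the four doublings; adding 2 puts `1 - L⁻¹` strictly between 0 and 1.
  set L : ℝ≥0 := K ^ 4 + 2 with hL
  have hL2 : 2 ≤ L := le_add_self
  have hL0 : 0 < L := lt_of_lt_of_le two_pos hL2
  have hLinv : L⁻¹ < 1 := inv_lt_one_of_one_lt₀ (lt_of_lt_of_le one_lt_two hL2)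
  refine ⟨1 - L⁻¹, tsub_pos_of_lt hLinv, tsub_lt_self one_pos (inv_pos.2 hL0), ?_⟩
  intro a b hab
  have hfin : μ (dbl a b) ≠ ∞ := isCompact_Icc.measure_lt_top.ne
  set c := b + (b - a) / 4 with hc
  set r := (b - a) / 8 with hr
  have hr0 : 0 < r := by rw [hr]; linarith
  have h1 : μ (dbl a b) ≤ L * μ (Icc (c - r) (c + r)) := by
    calc μ (dbl a b) ≤ μ (Icc (c - 2 ^ 4 * r) (c + 2 ^ 4 * r)) := by
          refine measure_mono (Icc_subset_Icc ?_ ?_)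
          · rw [hc, hr]; linarith
          · rw [hc, hr]; linarith
      _ ≤ (K : ℝ≥0∞) ^ 4 * μ (Icc (c - r) (c + r)) := measure_Icc_two_pow_le hK c hr0 4
      _ ≤ L * μ (Icc (c - r) (c + r)) := by
          gcongr
          rw [hL]
          push_cast
          exact le_self_add
  have h2 : μ (Icc a b) + μ (Icc (c - r) (c + r)) ≤ μ (dbl a b) := by
    rw [← measure_union _ measurableSet_Icc]
    · refine measure_mono (union_subset (Icc_subset_dbl hab) (Icc_subset_Icc ?_ ?_))
      · rw [hc, hr]; linarith
      · rw [hc, hr]; linarith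
    · rw [Set.disjoint_left]
      rintro x ⟨-, hx⟩ ⟨hx', -⟩
      rw [hc, hr] at hx'
      linarith
  have h3 : (L : ℝ≥0∞)⁻¹ * μ (dbl a b) ≤ μ (Icc (c - r) (c + r)) := by
    rw [mul_comm, ← div_eq_mul_inv]
    exact ENNReal.div_le_of_le_mul' h1
  rw [ENNReal.coe_sub, ENNReal.coe_one, ENNReal.coe_inv hL0.ne', ENNReal.sub_mul fun _ _ => hfin,
    one_mul]
  refine ENNReal.le_sub_of_add_le_right ?_ ((add_le_add_right h3 _).trans h2)
  exact ENNReal.mul_ne_top (by simpa using hL0.ne') hfin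

lemma exists_forall_rpow_mul_rpow_le_one (C : ℝ≥0) {γ : ℝ≥0} (hγ0 : 0 < γ) (hγ1 : γ < 1) :
    ∃ θ₀ ∈ Ioo (0 : ℝ) 1, ∀ θ ∈ Ioo 0 θ₀,
      (C : ℝ≥0∞) ^ θ * (γ : ℝ≥0∞) ^ (1 - θ) ≤ 1 := by
  -- A positive base makes `θ ↦ c ^ θ` continuous at 0, where the product equals `γ < 1`.
  set c : ℝ := C + 1 with hc
  have hc0 : 0 < c := by positivity
  have hcont : ContinuousAt (fun θ : ℝ => c ^ θ * (γ : ℝ) ^ (1 - θ)) 0 := by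
    refine ContinuousAt.mul ?_ ?_
    · exact Real.continuousAt_const_rpow hc0.ne'
    · exact (Real.continuousAt_const_rpow (by exact_mod_cast hγ0.ne')).comp
        (continuousAt_const.sub continuousAt_id)
  have hev : ∀ᶠ θ in 𝓝 (0 : ℝ), c ^ θ * (γ : ℝ) ^ (1 - θ) < 1 :=
    hcont.eventually_lt continuousAt_const (by simpa using hγ1)
  obtain ⟨ε, hε, h⟩ := Metric.eventually_nhds_iff.1 hev
  refine ⟨min ε (1 / 2), ⟨by positivity, (min_le_right _ _).trans_lt (by norm_num)⟩, ?_⟩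
  rintro θ ⟨h0, h1⟩
  have := h (y := θ) (by
    rw [Real.dist_eq, sub_zero, abs_of_pos h0]; exact h1.trans_le (min_le_left _ _))
  have h12 : θ < 1 / 2 := h1.trans_le (min_le_right _ _)
  rw [← ENNReal.coe_rpow_of_nonneg _ h0.le, ← ENNReal.coe_rpow_of_nonneg _ (by linarith),
    ← ENNReal.coe_mul, ← ENNReal.coe_one, ENNReal.coe_le_coe]
  rw [← NNReal.coe_le_coe]
  push_cast
  refine le_trans ?_ this.le
  gcongr
  rw [hc]
  linarith

/-- Hölder between the kernel of exponent `-β` and the constant 1 trades the large `C` for `C ^ θ *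
γ ^ (1 - θ)`. -/
theorem exists_forall_isFracAInftyWith_id {μ : Measure ℝ} [IsLocallyFiniteMeasure μ]
    (hμ : IsDoubling μ) {β : ℝ} (hβ0 : 0 < β) (hβ1 : β < 1) {C : ℝ≥0}
    (hpot : ∀ a b : ℝ, a < b → ∀ y : ℝ,
      ∫⁻ x in Icc a b, ENNReal.ofReal |x - y| ^ (-β) ∂μ ≤
        C * ENNReal.ofReal (2 * (b - a)) ^ (-β) * μ (Icc a b)) :
    ∃ α₀ ∈ Ioo (0 : ℝ) 1, ∀ α ∈ Ioo α₀ 1, IsFracAInftyWith α (fun t => t) μ := by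
  obtain ⟨γ, hγ0, hγ1, hγ⟩ := hμ.exists_measure_Icc_le
  obtain ⟨θ₀, ⟨hθ0, hθ1⟩, hθ⟩ := exists_forall_rpow_mul_rpow_le_one C hγ0 hγ1
  have hlt : θ₀ * β < 1 := by nlinarith
  -- Writing `α - 1 = -β * θ`, the condition `α > α₀` becomes `θ < θ₀`.
  refine ⟨1 - θ₀ * β, ⟨by linarith, by nlinarith⟩, ?_⟩
  rintro α ⟨hα0, hα1⟩
  obtain ⟨θ, hθα⟩ : ∃ θ, α - 1 = -β * θ := ⟨(1 - α) / β, by field_simp; ring⟩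
  have ht0 : 0 < θ := by by_contra! h; nlinarith
  have ht1 : θ < θ₀ := by by_contra! h; nlinarith
  have h1θ : 0 < 1 - θ := by linarith
  refine isFracAInftyWith_id fun a b hab y => ?_
  have hmeas : Measurable fun x : ℝ => ENNReal.ofReal |x - y| ^ (-β) := by fun_prop
  rw [hθα]
  calc ∫⁻ x in Icc a b, ENNReal.ofReal |x - y| ^ (-β * θ) ∂μ
      = ∫⁻ x in Icc a b, (ENNReal.ofReal |x - y| ^ (-β)) ^ θ * 1 ^ (1 - θ) ∂μ := by
        simp only [ENNReal.rpow_mul, ENNReal.one_rpow, mul_one]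
    _ ≤ (∫⁻ x in Icc a b, ENNReal.ofReal |x - y| ^ (-β) ∂μ) ^ θ *
          (∫⁻ _ in Icc a b, 1 ∂μ) ^ (1 - θ) :=
        ENNReal.lintegral_mul_norm_pow_le hmeas.aemeasurable aemeasurable_const ht0.le h1θ.le
          (by ring)
    _ ≤ (C * ENNReal.ofReal (2 * (b - a)) ^ (-β) * μ (dbl a b)) ^ θ *
          (γ * μ (dbl a b)) ^ (1 - θ) := by
        gcongr
        · exact (hpot a b hab y).trans (mul_le_mul_right (measure_mono (Icc_subset_dbl hab)) _)
        · simpa using hγ a b hab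
    _ = (C ^ θ * γ ^ (1 - θ)) * (ENNReal.ofReal (2 * (b - a)) ^ (-β * θ) *
          (μ (dbl a b) ^ θ * μ (dbl a b) ^ (1 - θ))) := by
        rw [ENNReal.mul_rpow_of_nonneg _ _ ht0.le, ENNReal.mul_rpow_of_nonneg _ _ ht0.le,
          ENNReal.mul_rpow_of_nonneg _ _ h1θ.le, ENNReal.rpow_mul]
        ring
    _ = (C ^ θ * γ ^ (1 - θ)) * (ENNReal.ofReal (2 * (b - a)) ^ (-β * θ) * μ (dbl a b)) := by
        rw [← ENNReal.rpow_add_of_nonneg _ _ ht0.le h1θ.le, add_sub_cancel, ENNReal.rpow_one]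
    _ ≤ 1 * (ENNReal.ofReal (2 * (b - a)) ^ (-β * θ) * μ (dbl a b)) := by
        gcongr
        exact hθ θ ⟨ht0, ht1⟩
    _ = _ := one_mul _

/-! ### Singularity by differentiation along triadic intervals -/

lemma triadic_eq_closedBall (m : ℕ) (k : ℤ) :
    triadic m k = Metric.closedBall (((k : ℝ) + 1 / 2) / 3 ^ m) (1 / 2 / 3 ^ m) := by
  rw [triadic, Real.closedBall_eq_Icc, ← sub_div, ← add_div]
  congr 2 <;> ring

lemma volume_triadic (m : ℕ) (k : ℤ) : volume (triadic m k) = ((3 : ℝ≥0∞) ^ m)⁻¹ := by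
  rw [triadic, Real.volume_Icc, ← sub_div, add_sub_cancel_left, one_div,
    ENNReal.ofReal_inv_of_pos (by positivity), ENNReal.ofReal_pow (by norm_num)]
  simp

lemma mem_triadic_floor (m : ℕ) (x : ℝ) : x ∈ triadic m ⌊x / 3 ^ (-m : ℤ)⌋ :=
  cell_neg_subset_triadic _ _ (mem_cell_floor _ x)

/-- Lebesgue differentiation along balls that contain `x` but need not be centred at it. -/
lemma ae_tendsto_triadic_ratio (μ : Measure ℝ) [IsLocallyFiniteMeasure μ] :
    ∀ᵐ x : ℝ, Tendsto (fun m : ℕ => μ (triadic m ⌊x / 3 ^ (-m : ℤ)⌋) * 3 ^ m) atTop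
      (𝓝 (μ.rnDeriv volume x)) := by
  filter_upwards [VitaliFamily.ae_tendsto_rnDeriv
    (IsUnifLocDoublingMeasure.vitaliFamily (volume : Measure ℝ) 1) μ] with x hx
  have hδ : Tendsto (fun m : ℕ => (1 / 2 : ℝ) / 3 ^ m) atTop (𝓝[>] 0) := by
    refine tendsto_nhdsWithin_iff.2 ⟨?_, Eventually.of_forall fun m => ?_⟩
    · have := (tendsto_pow_atTop_nhds_zero_of_lt_one (r := (1 / 3 : ℝ)) (by norm_num)
        (by norm_num)).const_mul (1 / 2 : ℝ)
      simpa [div_eq_mul_inv] using this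
    · exact mem_Ioi.2 (by positivity)
  have := hx.comp (IsUnifLocDoublingMeasure.tendsto_closedBall_filterAt (volume : Measure ℝ)
    (K := 1) (fun m : ℕ => ((⌊x / 3 ^ (-m : ℤ)⌋ : ℝ) + 1 / 2) / 3 ^ m) _ hδ
    (Eventually.of_forall fun m => by
      rw [one_mul, ← triadic_eq_closedBall]
      exact mem_triadic_floor m x))
  refine this.congr fun m => ?_
  rw [Function.comp_apply, ← triadic_eq_closedBall, volume_triadic, div_eq_mul_inv, inv_inv]

theorem IsTriadic.mutuallySingular {p : Fin 3 → ℝ≥0∞} {μ : Measure ℝ} [IsLocallyFiniteMeasure μ]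
    (hμ : IsTriadic p μ) (hp : ∀ j, p j < 3⁻¹ ∨ 3⁻¹ < p j) :
    μ ⟂ₘ volume := by
  rw [← Measure.rnDeriv_eq_zero]
  filter_upwards [ae_tendsto_triadic_ratio μ, Measure.rnDeriv_lt_top μ volume] with x hx hxtop
  by_contra hx0
  set u : ℕ → ℝ≥0∞ := fun m => μ (triadic m ⌊x / 3 ^ (-m : ℤ)⌋) * 3 ^ m with hu
  have hstep : ∀ m, ∃ j, u (m + 1) = 3 * p j * u m := by
    intro m
    obtain ⟨l, j, hl⟩ := exists_eq_three_mul_add ⌊x / 3 ^ (-(m + 1 : ℕ) : ℤ)⌋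
    have hmem := mem_cell_floor (-(m + 1 : ℕ) : ℤ) x
    rw [hl] at hmem
    have := floor_eq_of_mem_cell (cell_subset_cell_succ _ _ _ hmem)
    rw [show (-(m + 1 : ℕ) : ℤ) + 1 = -m by push_cast; ring] at this
    refine ⟨j, ?_⟩
    simp only [hu]
    rw [hl, this, hμ.succ, pow_succ]
    ring
  -- A positive finite limit would force successive ratios to 1, but they take only the finitely
  -- many values `3 * p j`, none equal to 1.
  have hratio : Tendsto (fun m => u (m + 1) / u m) atTop (𝓝 1) := by
    have := ENNReal.Tendsto.div (hx.comp (tendsto_add_atTop_nat 1)) (Or.inl hx0) hx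
      (Or.inl hxtop.ne)
    rwa [ENNReal.div_self hx0 hxtop.ne] at this
  have hpos : ∀ᶠ m in atTop, 0 < u m := hx.eventually (lt_mem_nhds (pos_iff_ne_zero.2 hx0))
  have hfin : ∀ᶠ m in atTop, u m < ∞ := hx.eventually (gt_mem_nhds hxtop)
  have hne : ∀ j, 3 * p j ≠ 1 := by
    intro j hj
    have : p j = 3⁻¹ := ENNReal.eq_inv_of_mul_eq_one_left (by rwa [mul_comm] at hj)
    rcases hp j with h | h <;> exact absurd this (by first | exact h.ne | exact h.ne')
  have hev : ∀ᶠ y in 𝓝 (1 : ℝ≥0∞), ∀ j, y ≠ 3 * p j :=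
    eventually_all.2 fun j => isOpen_ne.mem_nhds (hne j).symm
  obtain ⟨m, h1, h2, h3⟩ := (hpos.and (hfin.and (hratio.eventually hev))).exists
  obtain ⟨j, hj⟩ := hstep m
  exact h3 j (by rw [hj, ENNReal.mul_div_cancel_right h1.ne' h2.ne])

/-! ### Failure of `A_∞` and assembly -/

theorem IsTriadic.isGKS {δ : ℝ} {p : Fin 3 → ℝ≥0∞} {μ : Measure ℝ} (hμ : IsTriadic p μ)
    (h0 : p 0 = ENNReal.ofReal ((1 - δ) / 2)) (h1 : p 1 = ENNReal.ofReal δ)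
    (h2 : p 2 = ENNReal.ofReal ((1 - δ) / 2)) : IsGKS δ μ := by
  refine ⟨?_, hμ.periodic, fun m k _ _ => ⟨?_, ?_, ?_⟩⟩
  · simpa [triadic] using hμ.unit 0
  · simpa [h0] using hμ.succ m k 0
  · simpa [h1] using hμ.succ m k 1
  · simpa [h2] using hμ.succ m k 2

lemma IsAInfty.absolutelyContinuous {ω : Measure ℝ} (h : IsAInfty ω) : ω ≪ volume := by
  obtain ⟨p, -, -, w, -, rfl, -⟩ := h
  exact withDensity_absolutelyContinuous _ _

lemma AInftyInequality.absolutelyContinuous {ω : Measure ℝ} (h : AInftyInequality ω) :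
    ω ≪ volume := by
  obtain ⟨C, ε, hε, h⟩ := h
  refine Measure.AbsolutelyContinuous.mk fun s hs hs0 => ?_
  have hcover : s ⊆ ⋃ n : ℕ, s ∩ Icc (-(n + 1 : ℝ)) (n + 1) := by
    intro x hx
    obtain ⟨n, hn⟩ := exists_nat_ge |x|
    rw [abs_le] at hn
    exact mem_iUnion.2 ⟨n, hx, by linarith, by linarith⟩
  refine measure_mono_null hcover (measure_iUnion_null fun n => ?_)
  have hn : (-(n + 1 : ℝ)) < n + 1 := by
    have : (0 : ℝ) ≤ n := n.cast_nonneg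
    linarith
  have := h _ _ hn (s ∩ Icc (-(n + 1 : ℝ)) (n + 1)) (hs.inter measurableSet_Icc)
    inter_subset_right
  rw [measure_mono_null inter_subset_left hs0, ENNReal.zero_div, ENNReal.zero_rpow_of_pos hε,
    mul_zero, zero_mul] at this
  exact le_antisymm this zero_le

/-- With `β = 1 - α`, the stated range of `α` is exactly the convergence condition of the geometric
series. -/
lemma three_rpow_mul_lt_one {δ β : ℝ} (hδ : δ < 1)
    (hβ : β < Real.log (2 / (1 - δ)) / Real.log 3) :
    (3 : ℝ≥0∞) ^ β * ENNReal.ofReal ((1 - δ) / 2) < 1 := by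
  have h1 : 0 < (1 - δ) / 2 := by linarith
  rw [show (3 : ℝ≥0∞) = ENNReal.ofReal 3 by simp, ENNReal.ofReal_rpow_of_pos (by norm_num),
    ← ENNReal.ofReal_mul (by positivity), ENNReal.ofReal_lt_one]
  rw [lt_div_iff₀ (Real.log_pos (by norm_num)), ← Real.log_rpow (by norm_num),
    Real.log_lt_log_iff (by positivity) (div_pos two_pos (by linarith)),
    lt_div_iff₀ (by linarith)] at hβ
  linarith

end FracAInf

end

theorem mainTheorem9 (δ : ℝ) (hδ₀ : 0 < δ) (hδ₁ : δ < 1 / 3) :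
    ∃ μ : Measure ℝ,
      FracAInf.IsGKS δ μ ∧
      IsLocallyFiniteMeasure μ ∧
      μ ⟂ₘ volume ∧
      FracAInf.IsDoubling μ ∧
      (∃ α₀ ∈ Ioo (0 : ℝ) 1, ∀ α ∈ Ioo α₀ 1,
        FracAInf.IsFracAInftyWith α (fun t => t) μ) ∧
      (∀ α ∈ Ioo (1 - Real.log (2 / (1 - δ)) / Real.log 3) 1,
        ∃ C : ℝ≥0, FracAInf.IsFracAInftyWith α (fun t => min (C * t) 1) μ) ∧
      ¬ FracAInf.IsAInfty μ ∧
      ¬ FracAInf.AInftyInequality μ := by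
  set p : Fin 3 → ℝ≥0∞ :=
    ![ENNReal.ofReal ((1 - δ) / 2), ENNReal.ofReal δ, ENNReal.ofReal ((1 - δ) / 2)] with hp
  have p0 : p 0 = ENNReal.ofReal ((1 - δ) / 2) := rfl
  have p1 : p 1 = ENNReal.ofReal δ := rfl
  have p2 : p 2 = ENNReal.ofReal ((1 - δ) / 2) := rfl
  have hsum : ∑ j, p j = 1 := by
    rw [Fin.sum_univ_three, p0, p1, p2, ← ENNReal.ofReal_add (by linarith) hδ₀.le,
      ← ENNReal.ofReal_add (by linarith) (by linarith), ← ENNReal.ofReal_one]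
    congr 1
    ring
  have hq1 : ENNReal.ofReal ((1 - δ) / 2) < 1 := ENNReal.ofReal_lt_one.2 (by linarith)
  obtain ⟨μ, hμ⟩ := FracAInf.exists_isTriadic p hsum hq1 hq1
  have hpq : ∀ j, p j ≤ ENNReal.ofReal ((1 - δ) / 2) :=
    Fin.forall_fin_succ.2 ⟨le_rfl, Fin.forall_fin_two.2
      ⟨ENNReal.ofReal_le_ofReal (by linarith), le_rfl⟩⟩
  have hpos : ∀ j, 0 < p j :=
    Fin.forall_fin_succ.2 ⟨ENNReal.ofReal_pos.2 (by linarith), Fin.forall_fin_two.2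
      ⟨ENNReal.ofReal_pos.2 hδ₀, ENNReal.ofReal_pos.2 (by linarith)⟩⟩
  have h3 : (3⁻¹ : ℝ≥0∞) = ENNReal.ofReal (1 / 3) := by
    rw [one_div, ENNReal.ofReal_inv_of_pos (by norm_num)]; simp
  have hne : ∀ j, p j < 3⁻¹ ∨ 3⁻¹ < p j := by
    have hout : 3⁻¹ < ENNReal.ofReal ((1 - δ) / 2) := by
      rw [h3]; exact (ENNReal.ofReal_lt_ofReal_iff (by linarith)).2 (by linarith)
    have hmid : ENNReal.ofReal δ < 3⁻¹ := by
      rw [h3]; exact (ENNReal.ofReal_lt_ofReal_iff (by norm_num)).2 hδ₁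
    exact Fin.forall_fin_succ.2 ⟨Or.inr hout, Fin.forall_fin_two.2 ⟨Or.inl hmid, Or.inr hout⟩⟩
  have hR : ∃ R : ℝ≥0, 1 ≤ R ∧ p 0 ≤ R * p 1 := by
    have h1 : 1 ≤ (1 - δ) / 2 / δ := by rw [le_div_iff₀ hδ₀]; linarith
    refine ⟨((1 - δ) / 2 / δ).toNNReal, Real.one_le_toNNReal.2 h1, ?_⟩
    rw [p0, p1]
    change _ ≤ ENNReal.ofReal _ * _
    rw [← ENNReal.ofReal_mul (by linarith), div_mul_cancel₀ _ hδ₀.ne']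
  obtain ⟨R, hR1, hR2⟩ := hR
  have hreg : FracAInf.IsCellRegular (ENNReal.ofReal ((1 - δ) / 2)) R μ := by
    refine hμ.isCellRegular hpq hq1 ?_ hpos hR1 rfl hR2 ?_
    · rw [show (3 : ℝ≥0∞) = ENNReal.ofReal 3 by simp, ← ENNReal.ofReal_mul (by norm_num),
        ENNReal.one_le_ofReal]
      linarith
    · exact (hpq 1).trans (le_mul_of_one_le_left zero_le (by exact_mod_cast hR1))
  have := hreg.isLocallyFiniteMeasure
  have := hμ.nullSingletonClass hpq hq1
  have hdbl := hreg.isDoubling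
  have hsing : μ ⟂ₘ volume := hμ.mutuallySingular hne
  have hnac : ¬ μ ≪ volume := fun h =>
    hdbl.1 (Measure.eq_zero_of_absolutelyContinuous_of_mutuallySingular h hsing)
  have hpot : ∀ β, 0 < β → β < Real.log (2 / (1 - δ)) / Real.log 3 → ∃ C : ℝ≥0,
      ∀ a b : ℝ, a < b → ∀ y : ℝ, ∫⁻ x in Icc a b, ENNReal.ofReal |x - y| ^ (-β) ∂μ ≤
        C * ENNReal.ofReal (2 * (b - a)) ^ (-β) * μ (Icc a b) := fun β h0 h1 =>
    hreg.exists_potential_le h0 (FracAInf.three_rpow_mul_lt_one (by linarith) h1)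
  refine ⟨μ, hμ.isGKS p0 p1 p2, inferInstance, hsing, hdbl, ?_, ?_,
    fun h => hnac h.absolutelyContinuous, fun h => hnac h.absolutelyContinuous⟩
  · have hs : 0 < Real.log (2 / (1 - δ)) / Real.log 3 := by
      refine div_pos (Real.log_pos ?_) (Real.log_pos (by norm_num))
      rw [lt_div_iff₀ (by linarith)]
      linarith
    -- Any admissible exponent serves as the endpoint of the interpolation.
    obtain ⟨β, hβ0, hβ⟩ := exists_between (lt_min hs one_pos)
    obtain ⟨C, hC⟩ := hpot β hβ0 (hβ.trans_le (min_le_left _ _))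
    exact FracAInf.exists_forall_isFracAInftyWith_id hdbl hβ0 (hβ.trans_le (min_le_right _ _)) hC
  · rintro α ⟨hα0, hα1⟩
    obtain ⟨C, hC⟩ := hpot (1 - α) (by linarith) (by linarith)
    -- The duality bound divides by its constant, which must therefore be positive.
    refine ⟨C + 1, FracAInf.isFracAInftyWith_min (by positivity) fun a b hab y => ?_⟩
    have := hC a b hab y
    rw [neg_sub] at this
    refine this.trans ?_
    gcongr
    · exact le_self_add
    · exact FracAInf.Icc_subset_dbl hab
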